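/- Let $E_0\le E_1\le E_2\le E_3$ be real numbers whose gaps $\delta_i:=E_{i+1}-E_i$ are non-increasing, i.e. $\delta_0\ge\delta_1\ge\delta_2$. For $\beta\ge 0$ let $\vec p(\beta)\in\mathbb R^4$ be the thermal probability vector with components $p_i(\beta)=e^{-\beta E_i}/\sum_{j=0}^{3}e^{-\beta E_j}$, $i=0,\dots,3$. Let $0\le\beta'\le\beta$, write $p_i=p_i(\beta)$ and $p_{ij}=p_ip_j$, and put $$\vec q=(p_{00},p_{11},p_{22},p_{33})^T,\qquad \vec r_1=(p_{01},p_{12},p_{23},p_{30})^T,\qquad \vec r_2=(p_{02},p_{13},p_{20},p_{31})^T .$$ Let $\Pi$ be the $4\times4$ cyclic permutation matrix, $\Pi_{ij}=1$ if $i\equiv j+1 \pmod 4$ and $\Pi_{ij}=0$ otherwise $(i,j\in\{0,1,2,3\})$. (a) There exist doubly stochastic $4\times4$ matrices $M_q,M_{r_1},M_{r_2}$ such that $$\vec p(\beta')=M_q\,\vec q+(\mathbb 1+\Pi)\,M_{r_1}\vec r_1+\tfrac12(\mathbb 1+\Pi^2)\,M_{r_2}\vec r_2 .$$ (b) Consequently,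 symmetrically thermalizing unitaries exist for such Hamiltonians: for every Hermitian operator $H$ on $\mathbb C^4$ with eigenvalues $E_0,E_1,E_2,E_3$ (with multiplicity), with thermal states $\tau(\beta)=e^{-\beta H}/\mathrm{Tr}(e^{-\beta H})$, there is a unitary $U$ on $\mathbb C^4\otimes\mathbb C^4$ such that $$\mathrm{Tr}_B\bigl(U\,(\tau(\beta)\otimes\tau(\beta))\,U^\dagger\bigr)=\tau(\beta')=\mathrm{Tr}_A\bigl(U\,(\tau(\beta)\otimes\tau(\beta))\,U^\dagger\bigr).$$ -/

import Mathlib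

open scoped Matrix Kronecker

noncomputable section

/-- The energy gaps `δ i = E (i + 1) - E i`. -/
def energyGap {n : ℕ} (E : Fin (n + 1) → ℝ) (i : Fin n) : ℝ :=
  E i.succ - E i.castSucc

/-- The vector of thermal occupation probabilities `p i = exp (-β E i) / ∑ j, exp (-β E j)`. -/
def thermalVector {d : ℕ} (E : Fin d → ℝ) (β : ℝ) : Fin d → ℝ :=
  fun i => Real.exp (-β * E i) / ∑ j, Real.exp (-β * E j)

/-- The subspace vector `r i = ∑ j, p j * p (j + i) • e j` of the marginal of the product state with
diagonal entries `p j * p k`; indices are taken modulo `d` (addition in `Fin d` is modular). The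
vector called `q` is the case `i = 0`. -/
def subspaceVector {d : ℕ} [NeZero d] (p : Fin d → ℝ) (i : Fin d) : Fin d → ℝ :=
  fun j => p j * p (j + i)

/-- The cyclic permutation matrix, with entry `1` at `(i, j)` if `i = j + 1` modulo `d`, and `0`
otherwise. -/
def cyclicMatrix (d : ℕ) [NeZero d] : Matrix (Fin d) (Fin d) ℝ :=
  Matrix.of fun i j => if i = j + 1 then 1 else 0

/-- The matrix `H` is a Hamiltonian with energy eigenvalues `E` (with multiplicity): it equals
`∑ i, E i |v i⟩⟨v i|` where the orthonormal vectors `v i` are the columns of the unitary `V`. -/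
def HasEnergyEigenvalues {d : ℕ} (H : Matrix (Fin d) (Fin d) ℂ) (E : Fin d → ℝ) : Prop :=
  ∃ V ∈ Matrix.unitaryGroup (Fin d) ℂ, H = V * Matrix.diagonal (fun i => (E i : ℂ)) * Vᴴ

/-- The thermal state `exp (-β H) / Tr (exp (-β H))`. -/
def thermalState {d : ℕ} (H : Matrix (Fin d) (Fin d) ℂ) (β : ℝ) : Matrix (Fin d) (Fin d) ℂ :=
  (Matrix.trace (NormedSpace.exp (-(β : ℂ) • H)))⁻¹ • NormedSpace.exp (-(β : ℂ) • H)

/-- The partial trace over the second tensor factor. -/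
def partialTraceB {a b : Type*} [Fintype b] (ρ : Matrix (a × b) (a × b) ℂ) : Matrix a a ℂ :=
  Matrix.of fun i j => ∑ k, ρ (i, k) (j, k)

/-- The partial trace over the first tensor factor. -/
def partialTraceA {a b : Type*} [Fintype a] (ρ : Matrix (a × b) (a × b) ℂ) : Matrix b b ℂ :=
  Matrix.of fun i j => ∑ k, ρ (k, i) (k, j)

/-- `U` is a symmetrically thermalizing unitary for two copies of a system with Hamiltonian `H`,
initially both at inverse temperature `β`, with both final marginals thermal at `β'`. -/
def IsSTU {d : ℕ} (H : Matrix (Fin d) (Fin d) ℂ) (β β' : ℝ)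
    (U : Matrix (Fin d × Fin d) (Fin d × Fin d) ℂ) : Prop :=
  U ∈ Matrix.unitaryGroup (Fin d × Fin d) ℂ ∧
    partialTraceB (U * (thermalState H β ⊗ₖ thermalState H β) * Uᴴ) = thermalState H β' ∧
    partialTraceA (U * (thermalState H β ⊗ₖ thermalState H β) * Uᴴ) = thermalState H β'

end

/-! Write `p` for the thermal vector at `β` and `x` for the one at `β'`. The passage from `p` to `x`
goes through `y = (p 0 - u, p 1 + u, p 2 - v, p 3 + v)`, followed by partial averaging within the
level pairs {0,2} and {1,3}; `exists_transfers` supplies `u` and `v`.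

Both stages are realised inside the sectors. The transfers come from mixing `p 0 ^ 2` with `p 1 ^ 2`
and `p 2 ^ 2` with `p 3 ^ 2` in `q`, and `p 0 * p 2` with `p 1 * p 3` in `r₂`
(`exists_rotation_angles`). The averaging then acts directly on `q`, acts on `r₁` as a tensor
product that passes through `1 + Π`, and fixes the `r₂` term, which is equal on levels 0, 2 and on
levels 1, 3. The inequalities needed are comparisons of thermal weights
(`thermalVector_comparison`).

All doubly stochastic matrices used are entrywise squares of orthogonal matrices. These rotations,
placed on the sectors spanned by `|j, j + i⟩`, form a unitary, and mirroring sector 1 in sector 3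
makes the two marginals agree (`exists_isSTU_of_orthogonal`). -/

/-! ### Orthogonal matrices and their entrywise squares -/

/-- Turns an admissible amount of transfer into the cosine and sine of a plane rotation. -/
theorem exists_eq_mul_of_mem_Icc {s t : ℝ} (hs : 0 ≤ s) (hst : s ≤ t) :
    ∃ c d : ℝ, c ^ 2 + d ^ 2 = 1 ∧ s = d ^ 2 * t := by
  have hθ : ∃ θ : ℝ, 0 ≤ θ ∧ θ ≤ 1 ∧ s = θ * t := by
    rcases (hs.trans hst).eq_or_lt with h | h
    · exact ⟨0, le_rfl, zero_le_one, by linarith⟩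
    · exact ⟨s / t, by positivity, (div_le_one h).2 hst, by field_simp⟩
  obtain ⟨θ, h0, h1, h⟩ := hθ
  refine ⟨√(1 - θ), √θ, ?_, ?_⟩
  · rw [Real.sq_sqrt (by linarith), Real.sq_sqrt h0]; ring
  · rw [Real.sq_sqrt h0, h]

/-- Averaging within the pairs `{0, 1}` and `{2, 3}`, followed by averaging within the pairs
`{0, 2}` and `{1, 3}`, as an orthogonal matrix. -/
def pairRotation (ca sa cb sb ck sk cl sl : ℝ) : Matrix (Fin 4) (Fin 4) ℝ :=
  !![ca * ck, -(ca * sk), -(sa * cl), sa * sl;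
     cb * sk, cb * ck, -(sb * sl), -(sb * cl);
     sa * ck, -(sa * sk), ca * cl, -(ca * sl);
     sb * sk, sb * ck, cb * sl, cb * cl]

/-- The tensor product of two plane rotations, in the basis order `00, 10, 11, 01`. -/
def tensorRotation (ca sa cb sb : ℝ) : Matrix (Fin 4) (Fin 4) ℝ :=
  !![ca * cb, -(sa * cb), sa * sb, -(ca * sb);
     sa * cb, ca * cb, -(ca * sb), -(sa * sb);
     sa * sb, ca * sb, ca * cb, sa * cb;
     ca * sb, -(sa * sb), -(sa * cb), ca * cb]

theorem pairRotation_mem_orthogonalGroup {ca sa cb sb ck sk cl sl : ℝ}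
    (ha : ca ^ 2 + sa ^ 2 = 1) (hb : cb ^ 2 + sb ^ 2 = 1) (hk : ck ^ 2 + sk ^ 2 = 1)
    (hl : cl ^ 2 + sl ^ 2 = 1) :
    pairRotation ca sa cb sb ck sk cl sl ∈ Matrix.orthogonalGroup (Fin 4) ℝ := by
  rw [Matrix.mem_orthogonalGroup_iff]
  ext i j
  fin_cases i <;> fin_cases j <;>
    simp [pairRotation, Matrix.mul_apply, Fin.sum_univ_four] <;>
    grind

theorem tensorRotation_mem_orthogonalGroup {ca sa cb sb : ℝ}
    (ha : ca ^ 2 + sa ^ 2 = 1) (hb : cb ^ 2 + sb ^ 2 = 1) :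
    tensorRotation ca sa cb sb ∈ Matrix.orthogonalGroup (Fin 4) ℝ := by
  rw [Matrix.mem_orthogonalGroup_iff]
  ext i j
  fin_cases i <;> fin_cases j <;>
    simp [tensorRotation, Matrix.mul_apply, Fin.sum_univ_four] <;>
    grind

/-- Each input reaches each output along a single path through the two rounds of rotations, so
squaring entries produces no cross terms and yields the product of the two averagings. -/
theorem hadamard_pairRotation_mulVec {ca sa cb sb ck sk cl sl : ℝ}
    (ha : ca ^ 2 + sa ^ 2 = 1) (hb : cb ^ 2 + sb ^ 2 = 1) (hk : ck ^ 2 + sk ^ 2 = 1)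
    (hl : cl ^ 2 + sl ^ 2 = 1) (r₀ r₁ r₂ r₃ : ℝ) :
    (pairRotation ca sa cb sb ck sk cl sl ⊙ pairRotation ca sa cb sb ck sk cl sl) *ᵥ
      ![r₀, r₁, r₂, r₃] =
      ![(1 - sa ^ 2) * ((1 - sk ^ 2) * r₀ + sk ^ 2 * r₁) +
          sa ^ 2 * ((1 - sl ^ 2) * r₂ + sl ^ 2 * r₃),
        (1 - sb ^ 2) * (sk ^ 2 * r₀ + (1 - sk ^ 2) * r₁) +
          sb ^ 2 * (sl ^ 2 * r₂ + (1 - sl ^ 2) * r₃),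
        sa ^ 2 * ((1 - sk ^ 2) * r₀ + sk ^ 2 * r₁) +
          (1 - sa ^ 2) * ((1 - sl ^ 2) * r₂ + sl ^ 2 * r₃),
        sb ^ 2 * (sk ^ 2 * r₀ + (1 - sk ^ 2) * r₁) +
          (1 - sb ^ 2) * (sl ^ 2 * r₂ + (1 - sl ^ 2) * r₃)] := by
  rw [← eq_sub_iff_add_eq.2 ha, ← eq_sub_iff_add_eq.2 hb, ← eq_sub_iff_add_eq.2 hk,
    ← eq_sub_iff_add_eq.2 hl]
  ext i
  fin_cases i <;> simp [Matrix.mulVec, dotProduct, Fin.sum_univ_four, pairRotation] <;> ring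

/-- An entry of `r₁` picks one level from {0,2} and one from {1,3}. Applying `1 + Π` sums out one of
the two choices, leaving only the averaging of the other pair. -/
theorem hadamard_tensorRotation_mulVec {ca sa cb sb : ℝ}
    (ha : ca ^ 2 + sa ^ 2 = 1) (hb : cb ^ 2 + sb ^ 2 = 1) (r₀ r₁ r₂ r₃ : ℝ) :
    (tensorRotation ca sa cb sb ⊙ tensorRotation ca sa cb sb) *ᵥ ![r₀, r₁, r₂, r₃] =
      ![(1 - sb ^ 2) * ((1 - sa ^ 2) * r₀ + sa ^ 2 * r₁) +
          sb ^ 2 * (sa ^ 2 * r₂ + (1 - sa ^ 2) * r₃),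
        (1 - sb ^ 2) * (sa ^ 2 * r₀ + (1 - sa ^ 2) * r₁) +
          sb ^ 2 * ((1 - sa ^ 2) * r₂ + sa ^ 2 * r₃),
        sb ^ 2 * (sa ^ 2 * r₀ + (1 - sa ^ 2) * r₁) +
          (1 - sb ^ 2) * ((1 - sa ^ 2) * r₂ + sa ^ 2 * r₃),
        sb ^ 2 * ((1 - sa ^ 2) * r₀ + sa ^ 2 * r₁) +
          (1 - sb ^ 2) * (sa ^ 2 * r₂ + (1 - sa ^ 2) * r₃)] := by
  rw [← eq_sub_iff_add_eq.2 ha, ← eq_sub_iff_add_eq.2 hb]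
  ext i
  fin_cases i <;> simp [Matrix.mulVec, dotProduct, Fin.sum_univ_four, tensorRotation] <;> ring

theorem cyclicMatrix_mulVec {d : ℕ} [NeZero d] (w : Fin d → ℝ) (i : Fin d) :
    (cyclicMatrix d *ᵥ w) i = w (i - 1) := by
  simp [Matrix.mulVec, dotProduct, cyclicMatrix, ← sub_eq_iff_eq_add]

theorem hadamard_self_mem_doublyStochastic {n : Type*} [Fintype n] [DecidableEq n]
    {W : Matrix n n ℝ} (hW : W ∈ Matrix.orthogonalGroup n ℝ) : W ⊙ W ∈ doublyStochastic ℝ n := by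
  rw [mem_doublyStochastic_iff_sum]
  refine ⟨fun i j => mul_self_nonneg _, fun i => ?_, fun j => ?_⟩
  · have := congrFun (congrFun ((Matrix.mem_orthogonalGroup_iff n ℝ).1 hW) i) i
    simpa [Matrix.mul_apply] using this
  · have := congrFun (congrFun ((Matrix.mem_orthogonalGroup_iff' n ℝ).1 hW) j) j
    simpa [Matrix.mul_apply] using this

/-! ### From one probability vector to the other by transfers and averaging -/

/-- The transfers `u` from level `0` to level `1` and `v` from level `2` to level `3` after which
`p` becomes `x` by averaging levels `0, 2` and levels `1, 3`. -/
theorem exists_transfers {p x : Fin 4 → ℝ} (hp : ∑ i, p i = 1) (hx : ∑ i, x i = 1)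
    (hp23 : p 3 ≤ p 2) (hconv : p 2 - p 3 ≤ p 0 - p 1)
    (hx01 : x 1 ≤ x 0) (hx23 : x 3 ≤ x 2)
    (h01 : x 0 + x 1 ≤ p 0 + p 1) (h3 : p 3 ≤ x 3) (h02 : x 0 - x 2 ≤ p 0 - p 2)
    (hZ : x 0 + x 2 ≤ p 0 + p 2) :
    ∃ u v : ℝ, 0 ≤ v ∧ v ≤ p 2 - p 3 ∧ v ≤ u ∧ u ≤ (p 0 - p 1) / 2 ∧
      u + v = p 0 + p 2 - x 0 - x 2 ∧ x 1 - x 3 ≤ p 1 - p 3 + u - v ∧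
      x 0 - x 2 ≤ p 0 - p 2 - u + v := by
  rw [Fin.sum_univ_four] at hp hx
  set σ := p 0 + p 2 - x 0 - x 2 with hσ
  -- With `u + v = σ` fixed, only `d = u - v` is free. The constraints are three lower and three
  -- upper bounds on it; the largest lower bound is taken and the nine comparisons are linear.
  obtain ⟨d, hd⟩ : ∃ d, d = max (max 0 (σ - 2 * (p 2 - p 3))) (x 1 - x 3 - (p 1 - p 3)) := ⟨_, rfl⟩
  have l1 : 0 ≤ d := by rw [hd]; exact (le_max_left _ _).trans (le_max_left _ _)
  have l2 : σ - 2 * (p 2 - p 3) ≤ d := by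
    rw [hd]; exact (le_max_right _ _).trans (le_max_left _ _)
  have l3 : x 1 - x 3 - (p 1 - p 3) ≤ d := by rw [hd]; exact le_max_right _ _
  have u1 : d ≤ σ := by rw [hd]; refine max_le (max_le ?_ ?_) ?_ <;> linarith
  have u2 : d ≤ p 0 - p 1 - σ := by rw [hd]; refine max_le (max_le ?_ ?_) ?_ <;> linarith
  have u3 : d ≤ p 0 - p 2 - (x 0 - x 2) := by
    rw [hd]; refine max_le (max_le ?_ ?_) ?_ <;> linarith
  exact ⟨(σ + d) / 2, (σ - d) / 2, by linarith, by linarith, by linarith, by linarith, by ring,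
    by linarith, by linarith⟩

/-- Since `∑ p = 1`, the transfer `v` splits as `v * (p 2 + p 3)`, taken from `q`, plus `v * (p 0 +
p 1)`, taken from `r₂`. The latter moves the same amount from level 0 to level 1, so `q` supplies
only the rest of `u`. -/
theorem exists_rotation_angles {p x : Fin 4 → ℝ} (hp : ∑ i, p i = 1) (hx : ∑ i, x i = 1)
    (hp01 : p 1 ≤ p 0) (hp12 : p 2 ≤ p 1) (hp23 : p 3 ≤ p 2) (hp3 : 0 ≤ p 3)
    (hconv : p 2 - p 3 ≤ p 0 - p 1) (hlog : p 1 * p 2 ≤ p 0 * p 3)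
    (hx01 : x 1 ≤ x 0) (hx12 : x 2 ≤ x 1) (hx23 : x 3 ≤ x 2)
    (h01 : x 0 + x 1 ≤ p 0 + p 1) (h3 : p 3 ≤ x 3) (h02 : x 0 - x 2 ≤ p 0 - p 2)
    (hZ : x 0 + x 2 ≤ p 0 + p 2) :
    ∃ ca sa cb sb ck sk cl sl cm sm y₀ y₁ y₂ y₃ : ℝ,
      ca ^ 2 + sa ^ 2 = 1 ∧ cb ^ 2 + sb ^ 2 = 1 ∧ ck ^ 2 + sk ^ 2 = 1 ∧ cl ^ 2 + sl ^ 2 = 1 ∧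
      cm ^ 2 + sm ^ 2 = 1 ∧
      x 0 = (1 - sa ^ 2) * y₀ + sa ^ 2 * y₂ ∧ x 1 = (1 - sb ^ 2) * y₁ + sb ^ 2 * y₃ ∧
      x 2 = sa ^ 2 * y₀ + (1 - sa ^ 2) * y₂ ∧ x 3 = sb ^ 2 * y₁ + (1 - sb ^ 2) * y₃ ∧
      y₀ = ((1 - sk ^ 2) * (p 0 * p 0) + sk ^ 2 * (p 1 * p 1)) + p 0 * p 1 + p 3 * p 0
        + ((1 - sm ^ 2) * (p 0 * p 2) + sm ^ 2 * (p 1 * p 3)) ∧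
      y₁ = (sk ^ 2 * (p 0 * p 0) + (1 - sk ^ 2) * (p 1 * p 1)) + p 0 * p 1 + p 1 * p 2
        + (sm ^ 2 * (p 0 * p 2) + (1 - sm ^ 2) * (p 1 * p 3)) ∧
      y₂ = ((1 - sl ^ 2) * (p 2 * p 2) + sl ^ 2 * (p 3 * p 3)) + p 1 * p 2 + p 2 * p 3
        + ((1 - sm ^ 2) * (p 0 * p 2) + sm ^ 2 * (p 1 * p 3)) ∧
      y₃ = (sl ^ 2 * (p 2 * p 2) + (1 - sl ^ 2) * (p 3 * p 3)) + p 2 * p 3 + p 3 * p 0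
        + (sm ^ 2 * (p 0 * p 2) + (1 - sm ^ 2) * (p 1 * p 3)) := by
  obtain ⟨u, v, hv0, hvg, hvu, hu, huv, hY, hX⟩ :=
    exists_transfers hp hx hp23 hconv hx01 hx23 h01 h3 h02 hZ
  rw [Fin.sum_univ_four] at hp hx
  -- Capacities of the mixings: `hlog` gives `(p 2 - p 3) * (p 0 + p 1) ≤ p 0 * p 2 - p 1 * p 3`,
  -- and `p 0 + p 1 ≥ 1 / 2` gives `(p 0 - p 1) / 2 ≤ p 0 ^ 2 - p 1 ^ 2`.
  have hv01 : v * (p 0 + p 1) ≤ v := mul_le_of_le_one_right hv0 (by linarith)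
  have hv01' : v * (p 0 + p 1) ≤ (p 2 - p 3) * (p 0 + p 1) :=
    mul_le_mul_of_nonneg_right hvg (by linarith)
  have hv01₀ : 0 ≤ v * (p 0 + p 1) := mul_nonneg hv0 (by linarith)
  have hv23 : v * (p 2 + p 3) ≤ (p 2 - p 3) * (p 2 + p 3) :=
    mul_le_mul_of_nonneg_right hvg (by linarith)
  have hu' : 0 ≤ (p 0 - p 1) * (p 0 + p 1 - 1 / 2) := mul_nonneg (by linarith) (by linarith)
  obtain ⟨ca, sa, ha, hXa⟩ : ∃ c d : ℝ, c ^ 2 + d ^ 2 = 1 ∧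
      (p 0 - u) - x 0 = d ^ 2 * ((p 0 - u) - (p 2 - v)) :=
    exists_eq_mul_of_mem_Icc (by linarith) (by linarith)
  obtain ⟨cb, sb, hb, hYb⟩ : ∃ c d : ℝ, c ^ 2 + d ^ 2 = 1 ∧
      (p 1 + u) - x 1 = d ^ 2 * ((p 1 + u) - (p 3 + v)) :=
    exists_eq_mul_of_mem_Icc (by linarith) (by linarith)
  obtain ⟨ck, sk, hk, hku⟩ : ∃ c d : ℝ, c ^ 2 + d ^ 2 = 1 ∧
      u - v * (p 0 + p 1) = d ^ 2 * (p 0 * p 0 - p 1 * p 1) :=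
    exists_eq_mul_of_mem_Icc (by linarith) (by linarith)
  obtain ⟨cl, sl, hl, hlv⟩ : ∃ c d : ℝ, c ^ 2 + d ^ 2 = 1 ∧
      v * (p 2 + p 3) = d ^ 2 * (p 2 * p 2 - p 3 * p 3) :=
    exists_eq_mul_of_mem_Icc (mul_nonneg hv0 (by linarith)) (by linarith)
  obtain ⟨cm, sm, hm, hmv⟩ : ∃ c d : ℝ, c ^ 2 + d ^ 2 = 1 ∧
      v * (p 0 + p 1) = d ^ 2 * (p 0 * p 2 - p 1 * p 3) :=
    exists_eq_mul_of_mem_Icc hv01₀ (by linarith)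
  refine ⟨ca, sa, cb, sb, ck, sk, cl, sl, cm, sm, p 0 - u, p 1 + u, p 2 - v, p 3 + v,
    ha, hb, hk, hl, hm, by linarith, by linarith, by linarith, by linarith, ?_, ?_, ?_, ?_⟩
  · linear_combination p 0 * (-hp) - hku - hmv
  · linear_combination p 1 * (-hp) + hku + hmv
  · linear_combination (p 2 - v) * (-hp) - hlv - hmv
  · linear_combination (p 3 + v) * (-hp) + hlv + hmv

theorem subspaceVector_four (p : Fin 4 → ℝ) :
    subspaceVector p 0 = ![p 0 * p 0, p 1 * p 1, p 2 * p 2, p 3 * p 3] ∧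
    subspaceVector p 1 = ![p 0 * p 1, p 1 * p 2, p 2 * p 3, p 3 * p 0] ∧
    subspaceVector p 2 = ![p 0 * p 2, p 1 * p 3, p 2 * p 0, p 3 * p 1] := by
  refine ⟨?_, ?_, ?_⟩ <;> ext i <;> fin_cases i <;> rfl

theorem cyclic_combination (y w s : Fin 4 → ℝ) :
    y + (1 + cyclicMatrix 4) *ᵥ w + (1 / 2 : ℝ) • ((1 + cyclicMatrix 4 ^ 2) *ᵥ s) =
      ![y 0 + (w 0 + w 3) + (s 0 + s 2) / 2, y 1 + (w 1 + w 0) + (s 1 + s 3) / 2,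
        y 2 + (w 2 + w 1) + (s 2 + s 0) / 2, y 3 + (w 3 + w 2) + (s 3 + s 1) / 2] := by
  have s0 : (0 : Fin 4) - 1 = 3 := rfl
  have s2 : (2 : Fin 4) - 1 = 1 := rfl
  have s3 : (3 : Fin 4) - 1 = 2 := rfl
  ext i
  simp only [Pi.add_apply, Pi.smul_apply, Matrix.add_mulVec, Matrix.one_mulVec,
    pow_two (cyclicMatrix 4), ← Matrix.mulVec_mulVec, cyclicMatrix_mulVec, smul_eq_mul]
  fin_cases i <;> simp [s0, s2, s3] <;> ring

/-- The final clause, invariance of the `r₂` term under a shift by 2, serves the unitary: sector 2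
is its own mirror image. It holds because `W₂` uses the same angle on {0,1} and {2,3}. -/
theorem exists_orthogonal_decomposition {p x : Fin 4 → ℝ}
    (hp : ∑ i, p i = 1) (hx : ∑ i, x i = 1)
    (hp01 : p 1 ≤ p 0) (hp12 : p 2 ≤ p 1) (hp23 : p 3 ≤ p 2) (hp3 : 0 ≤ p 3)
    (hconv : p 2 - p 3 ≤ p 0 - p 1) (hlog : p 1 * p 2 ≤ p 0 * p 3)
    (hx01 : x 1 ≤ x 0) (hx12 : x 2 ≤ x 1) (hx23 : x 3 ≤ x 2)
    (h01 : x 0 + x 1 ≤ p 0 + p 1) (h3 : p 3 ≤ x 3) (h02 : x 0 - x 2 ≤ p 0 - p 2)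
    (hZ : x 0 + x 2 ≤ p 0 + p 2) :
    ∃ Wq ∈ Matrix.orthogonalGroup (Fin 4) ℝ, ∃ W₁ ∈ Matrix.orthogonalGroup (Fin 4) ℝ,
      ∃ W₂ ∈ Matrix.orthogonalGroup (Fin 4) ℝ,
        x = (Wq ⊙ Wq) *ᵥ subspaceVector p 0 +
          ((1 + cyclicMatrix 4) * (W₁ ⊙ W₁)) *ᵥ subspaceVector p 1 +
          (1 / 2 : ℝ) • (((1 + cyclicMatrix 4 ^ 2) * (W₂ ⊙ W₂)) *ᵥ subspaceVector p 2) ∧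
        ∀ i, ((W₂ ⊙ W₂) *ᵥ subspaceVector p 2) (i + 2) = ((W₂ ⊙ W₂) *ᵥ subspaceVector p 2) i := by
  obtain ⟨ca, sa, cb, sb, ck, sk, cl, sl, cm, sm, y₀, y₁, y₂, y₃, ha, hb, hk, hl, hm,
    e0, e1, e2, e3, f0, f1, f2, f3⟩ := exists_rotation_angles hp hx hp01 hp12 hp23 hp3 hconv hlog
      hx01 hx12 hx23 h01 h3 h02 hZ
  have hone : (1 : ℝ) ^ 2 + 0 ^ 2 = 1 := by norm_num
  obtain ⟨q0, q1, q2⟩ := subspaceVector_four p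
  refine ⟨pairRotation ca sa cb sb ck sk cl sl, pairRotation_mem_orthogonalGroup ha hb hk hl,
    tensorRotation ca sa cb sb, tensorRotation_mem_orthogonalGroup ha hb,
    pairRotation 1 0 1 0 cm sm cm sm, pairRotation_mem_orthogonalGroup hone hone hm hm, ?_, ?_⟩
  · rw [q0, q1, q2, ← Matrix.mulVec_mulVec, ← Matrix.mulVec_mulVec,
      hadamard_pairRotation_mulVec ha hb hk hl, hadamard_pairRotation_mulVec hone hone hm hm,
      hadamard_tensorRotation_mulVec ha hb, cyclic_combination]
    ext i
    fin_cases i <;> simp only [Fin.zero_eta, Fin.mk_one, Fin.reduceFinMk, Matrix.cons_val]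
    · rw [e0, f0, f2]; ring
    · rw [e1, f1, f3]; ring
    · rw [e2, f0, f2]; ring
    · rw [e3, f1, f3]; ring
  · intro i
    have t1 : (1 : Fin 4) + 2 = 3 := rfl
    have t2 : (2 : Fin 4) + 2 = 0 := rfl
    have t3 : (3 : Fin 4) + 2 = 1 := rfl
    rw [q2, hadamard_pairRotation_mulVec hone hone hm hm]
    fin_cases i <;> simp [t1, t2, t3] <;> ring

/-! ### Inequalities for thermal vectors -/

theorem thermalVector_pos {d : ℕ} [NeZero d] (E : Fin d → ℝ) (β : ℝ) (i : Fin d) :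
    0 < thermalVector E β i :=
  div_pos (Real.exp_pos _) (Finset.sum_pos (fun _ _ => Real.exp_pos _) Finset.univ_nonempty)

theorem sum_thermalVector {d : ℕ} [NeZero d] (E : Fin d → ℝ) (β : ℝ) :
    ∑ i, thermalVector E β i = 1 := by
  have : 0 < ∑ j, Real.exp (-β * E j) :=
    Finset.sum_pos (fun _ _ => Real.exp_pos _) Finset.univ_nonempty
  simp only [thermalVector, ← Finset.sum_div]
  exact div_self this.ne'

theorem thermalVector_le {d : ℕ} {E : Fin d → ℝ} {β : ℝ} (hβ : 0 ≤ β) {i j : Fin d}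
    (h : E i ≤ E j) : thermalVector E β j ≤ thermalVector E β i := by
  unfold thermalVector
  gcongr ?_ / _
  exact Real.exp_le_exp.2 (by nlinarith)

/-- Factor the right side as `exp (-β a) * (1 - exp (-β (b - a)))`: both factors dominate those of
the left side. -/
theorem exp_sub_le_exp_sub {β a b c d : ℝ} (hβ : 0 ≤ β) (hab : a ≤ b) (hac : a ≤ c)
    (hgap : d - c ≤ b - a) :
    Real.exp (-β * c) - Real.exp (-β * d) ≤ Real.exp (-β * a) - Real.exp (-β * b) := by
  have h1 : Real.exp (-β * d) = Real.exp (-β * c) * Real.exp (-(β * (d - c))) := by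
    rw [← Real.exp_add]; ring_nf
  have h2 : Real.exp (-β * b) = Real.exp (-β * a) * Real.exp (-(β * (b - a))) := by
    rw [← Real.exp_add]; ring_nf
  have h3 : Real.exp (-β * c) ≤ Real.exp (-β * a) := Real.exp_le_exp.2 (by nlinarith)
  have h4 : Real.exp (-(β * (b - a))) ≤ Real.exp (-(β * (d - c))) :=
    Real.exp_le_exp.2 (by nlinarith)
  have h5 : Real.exp (-(β * (b - a))) ≤ 1 := Real.exp_le_one_iff.2 (by nlinarith)
  have h6 := Real.exp_pos (-β * c)
  rw [h1, h2]
  nlinarith [mul_le_mul_of_nonneg_left h4 h6.le,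
    mul_le_mul_of_nonneg_right h3 (sub_nonneg.2 h5)]

/-- The comparison of the thermal vectors of a four-level system at two temperatures. -/
theorem thermalVector_comparison {E : Fin 4 → ℝ} {β β' : ℝ} (h01 : E 0 ≤ E 1) (h12 : E 1 ≤ E 2)
    (h23 : E 2 ≤ E 3) (hgap : E 2 - E 1 ≤ E 1 - E 0) (hβ' : 0 ≤ β') (hβ : β' ≤ β) :
    thermalVector E β' 0 + thermalVector E β' 1 ≤ thermalVector E β 0 + thermalVector E β 1 ∧
    thermalVector E β 3 ≤ thermalVector E β' 3 ∧
    thermalVector E β' 0 - thermalVector E β' 2 ≤ thermalVector E β 0 - thermalVector E β 2 ∧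
    thermalVector E β' 0 + thermalVector E β' 2 ≤ thermalVector E β 0 + thermalVector E β 2 := by
  -- With `e i = exp (-β' E i)` and `f i = exp (-γ E i)`, each cross-multiplied claim is a
  -- combination of terms `e i * e j * (f i - f j)`.
  obtain ⟨γ, hγ0, rfl⟩ : ∃ γ, 0 ≤ γ ∧ β = β' + γ := ⟨β - β', by linarith, by ring⟩
  have hsplit : ∀ i, Real.exp (-(β' + γ) * E i) = Real.exp (-β' * E i) * Real.exp (-γ * E i) := by
    intro i; rw [← Real.exp_add]; ring_nf
  have e21 : Real.exp (-β' * E 2) ≤ Real.exp (-β' * E 1) := Real.exp_le_exp.2 (by nlinarith)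
  have e10 : Real.exp (-β' * E 1) ≤ Real.exp (-β' * E 0) := Real.exp_le_exp.2 (by nlinarith)
  have f10 : Real.exp (-γ * E 1) ≤ Real.exp (-γ * E 0) := Real.exp_le_exp.2 (by nlinarith)
  have f21 : Real.exp (-γ * E 2) ≤ Real.exp (-γ * E 1) := Real.exp_le_exp.2 (by nlinarith)
  have f32 : Real.exp (-γ * E 3) ≤ Real.exp (-γ * E 2) := Real.exp_le_exp.2 (by nlinarith)
  have fconv := exp_sub_le_exp_sub hγ0 h01 h01 hgap
  have e0 := Real.exp_pos (-β' * E 0)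
  have e1 := Real.exp_pos (-β' * E 1)
  have e2 := Real.exp_pos (-β' * E 2)
  have e3 := Real.exp_pos (-β' * E 3)
  have f0 := Real.exp_pos (-γ * E 0)
  have f1 := Real.exp_pos (-γ * E 1)
  have f2 := Real.exp_pos (-γ * E 2)
  have f3 := Real.exp_pos (-γ * E 3)
  simp only [thermalVector, Fin.sum_univ_four, hsplit]
  generalize Real.exp (-β' * E 0) = e0 at *
  generalize Real.exp (-β' * E 1) = e1 at *
  generalize Real.exp (-β' * E 2) = e2 at *
  generalize Real.exp (-β' * E 3) = e3 at *
  generalize Real.exp (-γ * E 0) = f0 at *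
  generalize Real.exp (-γ * E 1) = f1 at *
  generalize Real.exp (-γ * E 2) = f2 at *
  generalize Real.exp (-γ * E 3) = f3 at *
  have g1 := sub_nonneg.2 f10
  have g2 := sub_nonneg.2 f21
  have g3 := sub_nonneg.2 f32
  have g01 := mul_nonneg e0.le g1
  have g02 := mul_nonneg e0.le g2
  have g03 := mul_nonneg e0.le g3
  refine ⟨?_, ?_, ?_, ?_⟩
  · rw [← add_div, ← add_div, div_le_div_iff₀ (by positivity) (by positivity)]
    nlinarith [mul_nonneg e2.le (mul_nonneg e0.le g1), mul_nonneg e2.le (mul_nonneg e0.le g2),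
      mul_nonneg e3.le (mul_nonneg e0.le g1), mul_nonneg e3.le (mul_nonneg e0.le g2),
      mul_nonneg e3.le (mul_nonneg e0.le g3), mul_nonneg e2.le (mul_nonneg e1.le g2),
      mul_nonneg e3.le (mul_nonneg e1.le g2), mul_nonneg e3.le (mul_nonneg e1.le g3)]
  · rw [div_le_div_iff₀ (by positivity) (by positivity)]
    nlinarith [mul_nonneg e3.le (mul_nonneg e0.le g1), mul_nonneg e3.le (mul_nonneg e0.le g2),
      mul_nonneg e3.le (mul_nonneg e0.le g3), mul_nonneg e3.le (mul_nonneg e1.le g2),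
      mul_nonneg e3.le (mul_nonneg e1.le g3), mul_nonneg e3.le (mul_nonneg e2.le g3)]
  · rw [← sub_div, ← sub_div, div_le_div_iff₀ (by positivity) (by positivity)]
    nlinarith [mul_nonneg e1.le g01, mul_nonneg e2.le g01, mul_nonneg e2.le g02,
      mul_nonneg e3.le g01, mul_nonneg e3.le (mul_nonneg (sub_nonneg.2 (e21.trans e10)) g2),
      mul_nonneg e3.le (mul_nonneg (sub_nonneg.2 (e21.trans e10)) g3),
      mul_nonneg e1.le (mul_nonneg e2.le g2), mul_nonneg e0.le g01, mul_nonneg e0.le g02]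
  -- The only negative term, `-e1 * e2 * (f1 - f2)`, is absorbed by `e0 * e1 * (f0 - f1)` thanks to
  -- `fconv`; this is where the gap hypothesis enters.
  · rw [← add_div, ← add_div, div_le_div_iff₀ (by positivity) (by positivity)]
    nlinarith [mul_nonneg e3.le g01, mul_nonneg e3.le g02, mul_nonneg e3.le g03,
      mul_nonneg e3.le (mul_nonneg e2.le g3),
      mul_nonneg (mul_nonneg e1.le (sub_nonneg.2 (e21.trans e10))) g1,
      mul_nonneg (mul_nonneg e1.le e2.le) (sub_nonneg.2 fconv)]

theorem exists_orthogonal_thermal_decomposition {E : Fin 4 → ℝ} {β β' : ℝ}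
    (hE : ∀ i : Fin 3, E i.castSucc ≤ E i.succ)
    (hgap : ∀ i : Fin 2, energyGap E i.succ ≤ energyGap E i.castSucc)
    (hβ' : 0 ≤ β') (hβ : β' ≤ β) :
    ∃ Wq ∈ Matrix.orthogonalGroup (Fin 4) ℝ, ∃ W₁ ∈ Matrix.orthogonalGroup (Fin 4) ℝ,
      ∃ W₂ ∈ Matrix.orthogonalGroup (Fin 4) ℝ,
        thermalVector E β' = (Wq ⊙ Wq) *ᵥ subspaceVector (thermalVector E β) 0 +
          ((1 + cyclicMatrix 4) * (W₁ ⊙ W₁)) *ᵥ subspaceVector (thermalVector E β) 1 +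
          (1 / 2 : ℝ) • (((1 + cyclicMatrix 4 ^ 2) * (W₂ ⊙ W₂)) *ᵥ
            subspaceVector (thermalVector E β) 2) ∧
        ∀ i, ((W₂ ⊙ W₂) *ᵥ subspaceVector (thermalVector E β) 2) (i + 2) =
          ((W₂ ⊙ W₂) *ᵥ subspaceVector (thermalVector E β) 2) i := by
  have h01 : E 0 ≤ E 1 := hE 0
  have h12 : E 1 ≤ E 2 := hE 1
  have h23 : E 2 ≤ E 3 := hE 2
  have g01 : E 2 - E 1 ≤ E 1 - E 0 := hgap 0
  have g12 : E 3 - E 2 ≤ E 2 - E 1 := hgap 1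
  have hβ0 := hβ'.trans hβ
  obtain ⟨c1, c2, c3, c4⟩ := thermalVector_comparison h01 h12 h23 g01 hβ' hβ
  have hS : 0 < ∑ j, Real.exp (-β * E j) :=
    Finset.sum_pos (fun _ _ => Real.exp_pos _) Finset.univ_nonempty
  refine exists_orthogonal_decomposition (sum_thermalVector E β) (sum_thermalVector E β')
    (thermalVector_le hβ0 h01) (thermalVector_le hβ0 h12) (thermalVector_le hβ0 h23)
    (thermalVector_pos E β 3).le ?_ ?_ (thermalVector_le hβ' h01) (thermalVector_le hβ' h12)
    (thermalVector_le hβ' h23) c1 c2 c3 c4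
  · simp only [thermalVector, ← sub_div]
    gcongr ?_ / _
    exact exp_sub_le_exp_sub hβ0 h01 (by linarith) (by linarith)
  · simp only [thermalVector, div_mul_div_comm, ← Real.exp_add]
    gcongr ?_ / _
    exact Real.exp_le_exp.2 (by nlinarith)

/-! ### Partial traces, thermal states and changes of basis -/

theorem partialTraceA_eq_partialTraceB {a b : Type*} [Fintype a] (ρ : Matrix (a × b) (a × b) ℂ) :
    partialTraceA ρ = partialTraceB (ρ.submatrix Prod.swap Prod.swap) := rfl

section PartialTrace

variable {a b : Type*} [Fintype a] [Fintype b]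

theorem partialTraceB_kronecker_conj (V : Matrix a a ℂ) {W : Matrix b b ℂ} [DecidableEq b]
    (hW : W ∈ Matrix.unitaryGroup b ℂ) (ρ : Matrix (a × b) (a × b) ℂ) :
    partialTraceB ((V ⊗ₖ W) * ρ * (V ⊗ₖ W)ᴴ) = V * partialTraceB ρ * Vᴴ := by
  have hW' : ∀ l l', ∑ k, W k l * star (W k l') = if l' = l then 1 else 0 := by
    intro l l'
    have := congrFun (congrFun (Matrix.mem_unitaryGroup_iff'.1 hW) l') l
    simpa [Matrix.mul_apply, Matrix.one_apply, mul_comm, Matrix.star_eq_conjTranspose] using this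
  ext i j
  calc partialTraceB ((V ⊗ₖ W) * ρ * (V ⊗ₖ W)ᴴ) i j
      = ∑ k, ∑ m', ∑ l', ∑ m, ∑ l, V i m * W k l * ρ (m, l) (m', l') *
          (star (V j m') * star (W k l')) := by
        simp [partialTraceB, Matrix.mul_apply, Fintype.sum_prod_type, Finset.sum_mul]
    _ = ∑ m', ∑ l', ∑ m, ∑ l, V i m * ρ (m, l) (m', l') * star (V j m') *
          ∑ k, W k l * star (W k l') := by
        rw [Finset.sum_comm]; refine Finset.sum_congr rfl fun m' _ => ?_
        rw [Finset.sum_comm]; refine Finset.sum_congr rfl fun l' _ => ?_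
        rw [Finset.sum_comm]; refine Finset.sum_congr rfl fun m _ => ?_
        rw [Finset.sum_comm]; refine Finset.sum_congr rfl fun l _ => ?_
        rw [Finset.mul_sum]
        exact Finset.sum_congr rfl fun k _ => by ring
    _ = (V * partialTraceB ρ * Vᴴ) i j := by
        simp only [hW', mul_ite, mul_one, mul_zero, Finset.sum_ite_eq, Finset.mem_univ, if_true]
        simp only [partialTraceB, Matrix.mul_apply, Matrix.of_apply, Matrix.conjTranspose_apply,
          Finset.mul_sum, Finset.sum_mul]
        exact Finset.sum_congr rfl fun m' _ => Finset.sum_comm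

theorem partialTraceA_kronecker_conj {V : Matrix a a ℂ} [DecidableEq a] (W : Matrix b b ℂ)
    (hV : V ∈ Matrix.unitaryGroup a ℂ) (ρ : Matrix (a × b) (a × b) ℂ) :
    partialTraceA ((V ⊗ₖ W) * ρ * (V ⊗ₖ W)ᴴ) = W * partialTraceA ρ * Wᴴ := by
  have h : (V ⊗ₖ W).submatrix (Equiv.prodComm b a) (Equiv.prodComm b a) = W ⊗ₖ V := by
    ext; simp [mul_comm]
  simp only [partialTraceA_eq_partialTraceB]
  rw [← partialTraceB_kronecker_conj W hV, ← h, Matrix.conjTranspose_submatrix]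
  change partialTraceB (Matrix.submatrix _ (Equiv.prodComm b a) (Equiv.prodComm b a)) =
    partialTraceB (_ * Matrix.submatrix _ (Equiv.prodComm b a) (Equiv.prodComm b a) * _)
  rw [Matrix.submatrix_mul_equiv, Matrix.submatrix_mul_equiv]

end PartialTrace

theorem thermalState_eq {d : ℕ} {V : Matrix (Fin d) (Fin d) ℂ}
    (hV : V ∈ Matrix.unitaryGroup (Fin d) ℂ) (E : Fin d → ℝ) (β : ℝ) :
    thermalState (V * Matrix.diagonal (fun i => (E i : ℂ)) * Vᴴ) β =
      V * Matrix.diagonal (fun i => (thermalVector E β i : ℂ)) * Vᴴ := by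
  have hVV : Vᴴ * V = 1 := Matrix.mem_unitaryGroup_iff'.1 hV
  have hinv : V⁻¹ = Vᴴ := Matrix.inv_eq_left_inv hVV
  have hu : IsUnit V := IsUnit.of_mul_eq_one_right _ hVV
  have hexp : NormedSpace.exp (-(β : ℂ) • (V * Matrix.diagonal (fun i => (E i : ℂ)) * Vᴴ)) =
      V * Matrix.diagonal (fun i => (Real.exp (-β * E i) : ℂ)) * Vᴴ := by
    rw [← hinv, ← Matrix.smul_mul, ← Matrix.mul_smul, Matrix.exp_conj _ _ hu,
      ← Matrix.diagonal_smul, Matrix.exp_diagonal]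
    congr 3
    ext i
    simp [Pi.coe_exp, Complex.exp_eq_exp_ℂ]
  have htr : Matrix.trace (V * Matrix.diagonal (fun i => (Real.exp (-β * E i) : ℂ)) * Vᴴ) =
      ∑ j, (Real.exp (-β * E j) : ℂ) := by
    rw [Matrix.trace_mul_comm, ← mul_assoc, hVV, one_mul, Matrix.trace_diagonal]
  rw [thermalState, hexp, htr, ← Matrix.smul_mul, ← Matrix.mul_smul, ← Matrix.diagonal_smul]
  congr 3
  ext i
  simp [thermalVector, div_eq_inv_mul]

theorem map_mul_diagonal_mul_conjTranspose_apply_self {n : Type*} [Fintype n]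
    [DecidableEq n] (W : Matrix n n ℝ) (r : n → ℝ) (j : n) :
    (W.map Complex.ofReal * Matrix.diagonal (fun i => (r i : ℂ)) * (W.map Complex.ofReal)ᴴ) j j =
      (((W ⊙ W) *ᵥ r) j : ℝ) := by
  rw [Matrix.mul_apply]
  simp only [Matrix.mul_diagonal, Matrix.map_apply, Matrix.conjTranspose_apply, Matrix.mulVec,
    dotProduct, Matrix.hadamard_apply]
  push_cast
  refine Finset.sum_congr rfl fun k _ => ?_
  rw [Complex.star_def, Complex.conj_ofReal]; ring

theorem map_ofReal_mem_unitaryGroup {n : Type*} [Fintype n] [DecidableEq n] {W : Matrix n n ℝ}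
    (hW : W ∈ Matrix.orthogonalGroup n ℝ) :
    W.map Complex.ofReal ∈ Matrix.unitaryGroup n ℂ := by
  have h := congrArg (fun A => Matrix.map A Complex.ofRealHom)
    ((Matrix.mem_orthogonalGroup_iff _ _).1 hW)
  rw [Matrix.mem_unitaryGroup_iff, Matrix.star_eq_conjTranspose]
  have e : (W.map Complex.ofReal)ᴴ = Wᵀ.map Complex.ofRealHom := by ext; simp
  rw [e]
  rw [Matrix.map_mul] at h
  exact h.trans (Matrix.map_one _ (map_zero _) (map_one _))

theorem submatrix_mem_orthogonalGroup {n : Type*} [Fintype n] [DecidableEq n] {W : Matrix n n ℝ}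
    (hW : W ∈ Matrix.orthogonalGroup n ℝ) (e : n ≃ n) :
    W.submatrix e e ∈ Matrix.orthogonalGroup n ℝ := by
  rw [Matrix.mem_orthogonalGroup_iff] at hW ⊢
  rw [Matrix.transpose_submatrix, Matrix.submatrix_mul_equiv, hW, Matrix.submatrix_one_equiv]

/-! ### Unitaries acting sector by sector -/

/-- The pairs of levels, grouped into the sectors with constant difference. -/
def sectorEquiv (d : ℕ) [NeZero d] : Fin d × Fin d ≃ Fin d × Fin d :=
  (Equiv.refl _).prodShear fun j => Equiv.subRight j

/-- The matrix acting by `W i` on the sector spanned by the vectors `|j, j + i⟩`. -/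
def sectorMatrix {d : ℕ} [NeZero d] (W : Fin d → Matrix (Fin d) (Fin d) ℂ) :
    Matrix (Fin d × Fin d) (Fin d × Fin d) ℂ :=
  (Matrix.blockDiagonal W).submatrix (sectorEquiv d) (sectorEquiv d)

section Sector

variable {d : ℕ} [NeZero d]

theorem sectorMatrix_mul (W W' : Fin d → Matrix (Fin d) (Fin d) ℂ) :
    sectorMatrix W * sectorMatrix W' = sectorMatrix fun i => W i * W' i := by
  rw [sectorMatrix, sectorMatrix, Matrix.submatrix_mul_equiv, ← Matrix.blockDiagonal_mul]; rfl

theorem conjTranspose_sectorMatrix (W : Fin d → Matrix (Fin d) (Fin d) ℂ) :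
    (sectorMatrix W)ᴴ = sectorMatrix fun i => (W i)ᴴ := by
  rw [sectorMatrix, Matrix.conjTranspose_submatrix, Matrix.blockDiagonal_conjTranspose]; rfl

theorem sectorMatrix_mem_unitaryGroup {W : Fin d → Matrix (Fin d) (Fin d) ℂ}
    (hW : ∀ i, W i ∈ Matrix.unitaryGroup (Fin d) ℂ) :
    sectorMatrix W ∈ Matrix.unitaryGroup (Fin d × Fin d) ℂ := by
  rw [Matrix.mem_unitaryGroup_iff, Matrix.star_eq_conjTranspose, conjTranspose_sectorMatrix,
    sectorMatrix_mul]
  have h : (fun i => W i * (W i)ᴴ) = 1 := funext fun i => Matrix.mem_unitaryGroup_iff.1 (hW i)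
  rw [h, sectorMatrix, Matrix.blockDiagonal_one, Matrix.submatrix_one_equiv]

theorem diagonal_kronecker_eq_sectorMatrix (p : Fin d → ℝ) :
    Matrix.diagonal (fun i => (p i : ℂ)) ⊗ₖ Matrix.diagonal (fun i => (p i : ℂ)) =
      sectorMatrix fun i => Matrix.diagonal fun j => (subspaceVector p i j : ℂ) := by
  rw [Matrix.diagonal_kronecker_diagonal, sectorMatrix, Matrix.blockDiagonal_diagonal,
    Matrix.submatrix_diagonal_equiv]
  congr 1
  ext ⟨i, j⟩
  simp [sectorEquiv, subspaceVector]

/-- Within a sector, the level of one factor determines that of the other, so the marginal has no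
off-diagonal entries. -/
theorem partialTraceB_sectorMatrix (N : Fin d → Matrix (Fin d) (Fin d) ℂ) :
    partialTraceB (sectorMatrix N) = Matrix.diagonal fun j => ∑ i, N i j j := by
  ext j k
  simp only [partialTraceB, sectorMatrix, sectorEquiv, Matrix.of_apply, Matrix.submatrix_apply,
    Matrix.blockDiagonal_apply, Equiv.prodShear_apply, Equiv.refl_apply, Equiv.subRight_apply,
    sub_right_inj, Matrix.diagonal_apply]
  split_ifs with h
  · subst h
    exact Equiv.sum_comp (Equiv.subRight j) fun i => N i j j
  · simp

theorem partialTraceA_sectorMatrix (N : Fin d → Matrix (Fin d) (Fin d) ℂ) :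
    partialTraceA (sectorMatrix N) = Matrix.diagonal fun j => ∑ i, N i (j - i) (j - i) := by
  ext j k
  simp only [partialTraceA, sectorMatrix, sectorEquiv, Matrix.of_apply, Matrix.submatrix_apply,
    Matrix.blockDiagonal_apply, Equiv.prodShear_apply, Equiv.refl_apply, Equiv.subRight_apply,
    sub_left_inj, Matrix.diagonal_apply]
  split_ifs with h
  · subst h
    rw [← Equiv.sum_comp (Equiv.subLeft j)]
    simp
  · simp

/-- Orthogonal matrices on the sectors yield a symmetrically thermalizing unitary as soon as both
marginals of the rotated state have the diagonal of the target state. -/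
theorem exists_isSTU_of_orthogonal {H : Matrix (Fin d) (Fin d) ℂ} {E : Fin d → ℝ} {β β' : ℝ}
    (hH : HasEnergyEigenvalues H E) (W : Fin d → Matrix (Fin d) (Fin d) ℝ)
    (hW : ∀ i, W i ∈ Matrix.orthogonalGroup (Fin d) ℝ)
    (hB : ∀ j, thermalVector E β' j =
      ∑ i, ((W i ⊙ W i) *ᵥ subspaceVector (thermalVector E β) i) j)
    (hA : ∀ j, thermalVector E β' j =
      ∑ i, ((W i ⊙ W i) *ᵥ subspaceVector (thermalVector E β) i) (j - i)) :
    ∃ U : Matrix (Fin d × Fin d) (Fin d × Fin d) ℂ, IsSTU H β β' U := by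
  obtain ⟨V, hV, rfl⟩ := hH
  set S := sectorMatrix fun i => (W i).map Complex.ofReal with hS
  have hSu : S ∈ Matrix.unitaryGroup _ ℂ :=
    sectorMatrix_mem_unitaryGroup fun i => map_ofReal_mem_unitaryGroup (hW i)
  have hVV : V ⊗ₖ V ∈ Matrix.unitaryGroup (Fin d × Fin d) ℂ := Matrix.kronecker_mem_unitary hV hV
  have hVV' : (V ⊗ₖ V)ᴴ * (V ⊗ₖ V) = 1 := Matrix.mem_unitaryGroup_iff'.1 hVV
  -- Conjugating the sector unitary by `V ⊗ₖ V` reduces everything to the energy eigenbasis.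
  have hρ : ∀ D : Matrix (Fin d) (Fin d) ℂ,
      (V ⊗ₖ V * S * (V ⊗ₖ V)ᴴ) * ((V * D * Vᴴ) ⊗ₖ (V * D * Vᴴ)) * (V ⊗ₖ V * S * (V ⊗ₖ V)ᴴ)ᴴ =
        V ⊗ₖ V * (S * (D ⊗ₖ D) * Sᴴ) * (V ⊗ₖ V)ᴴ := by
    intro D
    rw [Matrix.mul_kronecker_mul, Matrix.mul_kronecker_mul, ← Matrix.conjTranspose_kronecker]
    simp only [Matrix.conjTranspose_mul, Matrix.conjTranspose_conjTranspose, Matrix.mul_assoc]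
    simp only [← Matrix.mul_assoc (V ⊗ₖ V)ᴴ (V ⊗ₖ V), hVV', Matrix.one_mul]
  have hN : S * (Matrix.diagonal (fun i => (thermalVector E β i : ℂ)) ⊗ₖ
      Matrix.diagonal (fun i => (thermalVector E β i : ℂ))) * Sᴴ =
      sectorMatrix fun i => (W i).map Complex.ofReal *
        Matrix.diagonal (fun j => (subspaceVector (thermalVector E β) i j : ℂ)) *
          ((W i).map Complex.ofReal)ᴴ := by
    rw [diagonal_kronecker_eq_sectorMatrix, hS, conjTranspose_sectorMatrix, sectorMatrix_mul,
      sectorMatrix_mul]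
  refine ⟨V ⊗ₖ V * S * (V ⊗ₖ V)ᴴ, mul_mem (mul_mem hVV hSu) (Unitary.star_mem hVV), ?_, ?_⟩
  · rw [thermalState_eq hV, thermalState_eq hV, hρ, partialTraceB_kronecker_conj V hV, hN,
      partialTraceB_sectorMatrix]
    congr 3
    ext j
    simp only [map_mul_diagonal_mul_conjTranspose_apply_self]
    rw [hB]; push_cast; rfl
  · rw [thermalState_eq hV, thermalState_eq hV, hρ, partialTraceA_kronecker_conj V hV, hN,
      partialTraceA_sectorMatrix]
    congr 3
    ext j
    simp only [map_mul_diagonal_mul_conjTranspose_apply_self]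
    rw [hA]; push_cast; rfl

/-- Exchanging the two factors maps sector `i` onto sector `-i` with index shift `j ↦ j + i`, so the
shifted copy of `W` acts there as the mirror image. -/
theorem hadamard_submatrix_sub_mulVec_subspaceVector_neg (W : Matrix (Fin d) (Fin d) ℝ)
    (p : Fin d → ℝ) (i j : Fin d) :
    ((W.submatrix (Equiv.subRight i) (Equiv.subRight i) ⊙
      W.submatrix (Equiv.subRight i) (Equiv.subRight i)) *ᵥ subspaceVector p (-i)) j =
      ((W ⊙ W) *ᵥ subspaceVector p i) (j - i) := by
  simp only [Matrix.mulVec, dotProduct]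
  rw [← Equiv.sum_comp (Equiv.subRight i) fun k => (W ⊙ W) (j - i) k * subspaceVector p i k]
  refine Finset.sum_congr rfl fun k _ => ?_
  simp [subspaceVector, ← sub_eq_add_neg, mul_comm (p k)]

end Sector

/-! ### Assembly of the decomposition and the unitary -/

theorem mainTheorem3 (E : Fin 4 → ℝ) (β β' : ℝ)
    (hE : ∀ i : Fin 3, E i.castSucc ≤ E i.succ)
    (hgap : ∀ i : Fin 2, energyGap E i.succ ≤ energyGap E i.castSucc)
    (hβ' : 0 ≤ β') (hβ : β' ≤ β) :
    (∃ Mq ∈ doublyStochastic ℝ (Fin 4), ∃ Mr₁ ∈ doublyStochastic ℝ (Fin 4),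
      ∃ Mr₂ ∈ doublyStochastic ℝ (Fin 4),
        thermalVector E β' =
          Mq *ᵥ subspaceVector (thermalVector E β) 0 +
          ((1 + cyclicMatrix 4) * Mr₁) *ᵥ subspaceVector (thermalVector E β) 1 +
          (1 / 2 : ℝ) •
            (((1 + cyclicMatrix 4 ^ 2) * Mr₂) *ᵥ subspaceVector (thermalVector E β) 2)) ∧
    (∀ H : Matrix (Fin 4) (Fin 4) ℂ, HasEnergyEigenvalues H E →
      ∃ U : Matrix (Fin 4 × Fin 4) (Fin 4 × Fin 4) ℂ, IsSTU H β β' U) := by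
  obtain ⟨Wq, hq, W₁, h₁, W₂, h₂, hdec, hsymm⟩ :=
    exists_orthogonal_thermal_decomposition hE hgap hβ' hβ
  refine ⟨⟨_, hadamard_self_mem_doublyStochastic hq, _, hadamard_self_mem_doublyStochastic h₁,
    _, hadamard_self_mem_doublyStochastic h₂, hdec⟩, fun H hH => ?_⟩
  rw [← Matrix.mulVec_mulVec, ← Matrix.mulVec_mulVec, cyclic_combination] at hdec
  have hs0 := hsymm 0
  have hs1 := hsymm 1
  have h31 : ∀ j, _ = _ := hadamard_submatrix_sub_mulVec_subspaceVector_neg W₁ (thermalVector E β) 1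
  have n1 : -(1 : Fin 4) = 3 := rfl
  rw [n1] at h31
  have s0 : (0 : Fin 4) - 1 = 3 := rfl
  have s2 : (2 : Fin 4) - 1 = 1 := rfl
  have s3 : (3 : Fin 4) - 1 = 2 := rfl
  have t1 : (1 : Fin 4) + 2 = 3 := rfl
  have r02 : (0 : Fin 4) - 2 = 2 := rfl
  have r12 : (1 : Fin 4) - 2 = 3 := rfl
  have r32 : (3 : Fin 4) - 2 = 1 := rfl
  have r03 : (0 : Fin 4) - 3 = 1 := rfl
  have r13 : (1 : Fin 4) - 3 = 2 := rfl
  have r23 : (2 : Fin 4) - 3 = 3 := rfl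
  rw [zero_add] at hs0
  rw [t1] at hs1
  have d0 := congrFun hdec 0
  have d1 := congrFun hdec 1
  have d2 := congrFun hdec 2
  have d3 := congrFun hdec 3
  simp only [Matrix.cons_val] at d0 d1 d2 d3
  -- Sector 3 mirrors sector 1 and supplies the `Π` half of `1 + Π`; `hsymm` makes the factor `(1 +
  -- Π ^ 2) / 2` act trivially in sector 2.
  refine exists_isSTU_of_orthogonal hH
    ![Wq, W₁, W₂, W₁.submatrix (Equiv.subRight 1) (Equiv.subRight 1)] ?_ ?_ ?_
  · intro i
    fin_cases i
    exacts [hq, h₁, h₂, submatrix_mem_orthogonalGroup h₁ _]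
  all_goals
    intro j
    rw [Fin.sum_univ_four]
    simp only [Matrix.cons_val, h31]
    fin_cases j <;> simp [s0, s2, s3, r02, r12, r32, r03, r13, r23, d0, d1, d2, d3] <;> linarith
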